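/- **Setting (bandits against an $m$-memory-bounded adaptive adversary).** There are $\ell\ge 1$ arms and $T\ge 0$ rounds. Before the game, the adversary fixes loss functions $L_t:[\ell]^t\to[0,1]$, $t\ge 1$. It is $m$-memory-bounded if $L_t(a_1,\dots,a_t)$ depends only on $t$ and on the last $m+1$ actions $a_{\max(1,t-m)},\dots,a_t$. In round $t$ the learner plays $a_t\in[\ell]$ and observes only its own loss $L_t(a_1,\dots,a_t)$. Its policy regret is $$R_T=\mathbb E\Big[\sum_{t=1}^T L_t(a_1,\dots,a_t)\Big]-\min_{y\in[\ell]}\sum_{t=1}^T L_t(y,\dots,y).$$ **Algorithm.** The parameters are $\varepsilon\in[0,1]$ and $\eta\ge 0$; put $d=m+1$. The learner keeps the weights $w\in(0,\infty)^\ell$ of HEDGE, initially all equal to $1$, the distribution $x_t=w/\sum_j w(j)$, and an exploited arm $i_t$, where $i_1$ is uniform. Round $1$ is an exploitation round. * In an exploitation round $t$ it plays $i_t$ and draws $\beta_t\sim\mathrm{Bernoulli}(\varepsilon)$. If $\beta_t=0$, round $t+1$ is an exploitation round. * If $\beta_t=1$, it draws an arm $e$ uniformly at random and plays $e$ in the $d$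 rounds $t+1,\dots,t+d$ (as far as they are at most $T$). The observed loss $c$ of round $t+d$ is the feedback: $w(e)$ is replaced by $w(e)\exp(-\eta c)$, and the other weights are unchanged. Round $t+d+1$ is an exploitation round. * Weights and exploited arm change only after such feedback. If then $x_{t}\ne x_{t-1}$, the new exploited arm is chosen by the procedure Round: $i_t=j$ with probability $\tau_{i,j}/x_{t-1}(i)$, where $i=i_{t-1}$ and $\tau\ge 0$ is any transport plan from $x_{t-1}$ to $x_t$ (row sums $x_{t-1}$, column sums $x_t$) that moves the least possible mass, $\sum_{i\ne j}\tau_{i,j}=\sum_i\max(0,x_{t-1}(i)-x_t(i))$. If $x_t=x_{t-1}$, then $i_t=i_{t-1}$. All random choices are independent given the past. **Theorem.** There is a universal constant $C>0$ such that the following holds for all $\ell\ge 1$, $m\ge 1$ and $T\ge 0$. If $m\ell\ln\ell<T$, let $$\varepsilon=(\ell\ln\ell)^{1/3}m^{-2/3}T^{-1/3},\qquad 1-e^{-\eta}=(m\ell\ln\ell)^{1/3}T^{-1/3};$$ if $m\ell\ln\ell\ge T$, let $\varepsilon\in[0,1]$ and $\eta\ge 0$ be arbitrary. Then, for every choice of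 the transport plans and against every $m$-memory-bounded adaptive adversary, the algorithm has policy regret $$R_T\le C\,(m\,\ell\ln\ell)^{1/3}\,T^{2/3}.$$ -/

import Mathlib

noncomputable section

namespace MemoryBandit

/-! ### Bandits against adaptive adversaries -/

/-- An action history, most recent action first.  The history of the first `t` rounds is a list of
length `t`. -/
abbrev History (ℓ : ℕ) := List (Fin ℓ)

/-- An adaptive adversary: before the game it fixes, for every `t`, a function that assigns a loss
in `[0, 1]` to every sequence `a₁, …, a_t` of actions of the first `t` rounds.  The loss suffered
in round `t` is `loss [a_t, …, a₁]` (the round is the length of the history). -/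
structure Adversary (ℓ : ℕ) where
  loss : History ℓ → ℝ
  loss_mem : ∀ h, loss h ∈ Set.Icc (0 : ℝ) 1

/-- `m`-memory-bounded: in every round the loss depends only on the round and on the current action
and the `m` actions before it, that is, on the last `m + 1` actions. -/
def Adversary.MemoryBounded {ℓ : ℕ} (A : Adversary ℓ) (m : ℕ) : Prop :=
  ∀ h h' : History ℓ, h.length = h'.length → h.take (m + 1) = h'.take (m + 1) →
    A.loss h = A.loss h'

/-- The total loss `∑_{s ≤ t} loss (a₁, …, a_s)` along a history of `t` rounds. -/
def Adversary.totalLoss {ℓ : ℕ} (A : Adversary ℓ) : History ℓ → ℝ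
  | [] => 0
  | a :: h => A.loss (a :: h) + A.totalLoss h

/-- The expectation of a real random variable under a discrete law. -/
def expect {α : Type*} (p : PMF α) (φ : α → ℝ) : ℝ := ∑' a, (p a).toReal * φ a

/-- The policy regret of a random history `p` of `T` rounds: the expected total loss minus the
total loss `∑_{t ≤ T} loss (y, …, y)` of the best constant action sequence `y, …, y`. -/
def policyRegret {ℓ : ℕ} [NeZero ℓ] (A : Adversary ℓ) (T : ℕ) (p : PMF (History ℓ)) : ℝ :=
  expect p A.totalLoss -
    Finset.univ.inf' Finset.univ_nonempty fun y : Fin ℓ => A.totalLoss (List.replicate T y)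

/-! ### HEDGE -/

/-- The distribution played by HEDGE with weights `w`. -/
def hedgeDist {ℓ : ℕ} (w : Fin ℓ → ℝ) (i : Fin ℓ) : ℝ := w i / ∑ j, w j

/-- The HEDGE update with learning rate `η` after the loss vector `g`. -/
def hedgeUpdate {ℓ : ℕ} (η : ℝ) (w g : Fin ℓ → ℝ) (i : Fin ℓ) : ℝ := w i * Real.exp (-η * g i)

/-! ### The procedure Round -/

/-- `τ i j` is the mass moved from `i` to `j` by an optimal transport plan from the distribution
`p` to the distribution `q`, where moving a unit of mass between different points costs `1`. -/
def IsOptimalTransport {ℓ : ℕ} (p q : Fin ℓ → ℝ) (τ : Fin ℓ → Fin ℓ → ℝ) : Prop :=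
  (∀ i j, 0 ≤ τ i j) ∧ (∀ i, ∑ j, τ i j = p i) ∧ (∀ j, ∑ i, τ i j = q j) ∧
    ∑ i, ∑ j ∈ Finset.univ.erase i, τ i j = ∑ i, max 0 (p i - q i)

/-- A choice of an optimal transport plan between any two distributions on the arms. -/
def IsTransportRule {ℓ : ℕ} (τ : (Fin ℓ → ℝ) → (Fin ℓ → ℝ) → Fin ℓ → Fin ℓ → ℝ) : Prop :=
  ∀ p ∈ stdSimplex ℝ (Fin ℓ), ∀ q ∈ stdSimplex ℝ (Fin ℓ), IsOptimalTransport p q (τ p q)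

open Classical in
/-- `Round`: from `i`, move to `j` with probability `τ i j / p i`, where `τ` is a plan that
transports `p`.  (The second branch is never reached when `τ` is such a plan and `p i > 0`.) -/
def round {ℓ : ℕ} (p : Fin ℓ → ℝ) (τ : Fin ℓ → Fin ℓ → ℝ) (i : Fin ℓ) : PMF (Fin ℓ) :=
  if h : 0 < p i ∧ (∀ j, 0 ≤ τ i j) ∧ ∑ j, τ i j = p i then
    PMF.ofFintype (fun j => ENNReal.ofReal (τ i j / p i)) (by
      obtain ⟨hp, hτ, hs⟩ := h
      rw [← ENNReal.ofReal_sum_of_nonneg fun j _ => div_nonneg (hτ j) hp.le,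
        ← Finset.sum_div, hs, div_self hp.ne', ENNReal.ofReal_one])
  else PMF.pure i

/-! ### The algorithm -/

/-- A coin that shows `true` with probability `ε`. -/
def coin (ε : unitInterval) : PMF Bool :=
  PMF.ofFintype (fun b => ENNReal.ofReal (if b then (ε : ℝ) else 1 - ε)) (by
    rw [Fintype.sum_bool, ← ENNReal.ofReal_add (by simpa using ε.2.1) (by simpa using ε.2.2)]
    simp)

/-- The state of the algorithm between two rounds:
* `w`, the current weights of HEDGE, so that `x = hedgeDist w` is the current distribution;
* `i`, the exploited arm, rounded from `x`;
* `block = none` if the next round is an exploitation round, and `block = some (e, k)` if the next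
  `k` rounds form (the rest of) the bootstrapping of arm `e`, the last of these `k` rounds being
  the exploration round in which the loss of `e` is used as feedback;
* `hist`, the actions played so far. -/
structure State (ℓ : ℕ) where
  w : Fin ℓ → ℝ
  i : Fin ℓ
  block : Option (Fin ℓ × ℕ)
  hist : History ℓ

/-- The state before the first round: all weights are `1`, and the exploited arm is uniform. -/
def init (ℓ : ℕ) [NeZero ℓ] : PMF (State ℓ) :=
  (PMF.uniformOfFintype (Fin ℓ)).map fun i => ⟨fun _ => 1, i, none, []⟩

open Classical in
/-- One round with exploration probability `ε`, learning rate `η` and delay `d`.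

In an exploitation round `t` the exploited arm `i_t` is played and `β_t ∼ Bernoulli(ε)` is drawn.
If `β_t = 1`, a uniform arm `e` is drawn and the next `d` rounds `t + 1, …, t + d` are used to
explore it; otherwise round `t + 1` is again an exploitation round.

In the rounds `t + 1, …, t + d` the arm `e` is played.  The observed loss of round `t + d` is fed to
HEDGE as the loss of `e`, the other arms getting loss `0`.  If the distribution has changed,
`Round` chooses the new exploited arm.  Round `t + d + 1` is an exploitation round.

The adversary is accessed only through the loss of the action that is actually played. -/
def step {ℓ : ℕ} [NeZero ℓ] (A : Adversary ℓ) (ε : unitInterval) (η : ℝ) (d : ℕ)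
    (τ : (Fin ℓ → ℝ) → (Fin ℓ → ℝ) → Fin ℓ → Fin ℓ → ℝ) (s : State ℓ) : PMF (State ℓ) :=
  match s.block with
  | none =>
    (coin ε).bind fun β =>
      if β then
        (PMF.uniformOfFintype (Fin ℓ)).map fun e => ⟨s.w, s.i, some (e, d), s.i :: s.hist⟩
      else PMF.pure ⟨s.w, s.i, none, s.i :: s.hist⟩
  | some (e, k) =>
    if 1 < k then PMF.pure ⟨s.w, s.i, some (e, k - 1), e :: s.hist⟩
    else
      let g : Fin ℓ → ℝ := fun j => if j = e then A.loss (e :: s.hist) else 0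
      let w' := hedgeUpdate η s.w g
      let x := hedgeDist s.w
      let x' := hedgeDist w'
      (if x' ≠ x then round x (τ x x') s.i else PMF.pure s.i).map
        fun i' => ⟨w', i', none, e :: s.hist⟩

/-- The law of the state after `t` rounds. -/
def run {ℓ : ℕ} [NeZero ℓ] (A : Adversary ℓ) (ε : unitInterval) (η : ℝ) (d : ℕ)
    (τ : (Fin ℓ → ℝ) → (Fin ℓ → ℝ) → Fin ℓ → Fin ℓ → ℝ) : ℕ → PMF (State ℓ)
  | 0 => init ℓ
  | t + 1 => (run A ε η d τ t).bind (step A ε η d τ)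

/-- The law of the actions played in the first `T` rounds. -/
def play {ℓ : ℕ} [NeZero ℓ] (A : Adversary ℓ) (ε : unitInterval) (η : ℝ) (d : ℕ)
    (τ : (Fin ℓ → ℝ) → (Fin ℓ → ℝ) → Fin ℓ → Fin ℓ → ℝ) (T : ℕ) : PMF (History ℓ) :=
  (run A ε η d τ T).map State.hist

end MemoryBandit

end

/-!
The algorithm is analysed with one potential. In an exploitation round it consists of

* the number of further rounds until the memory of the adversary contains only the exploited arm,
  so that from then on losses are those of constant play;
* the regret that the current HEDGE distribution would suffer in the next `d` rounds, which pays for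
  the delay between the decision to explore and the feedback;
* a multiple of `-log x(y)`, the divergence of the HEDGE distribution `x` from the comparator `y`.
  An exploration of a uniformly random arm decreases it on average by a multiple of the regret of
  `x` in the round of the feedback, up to second order in the learning rate.

The expected loss plus potential grows in each exploitation round by at most the loss of `y` and
`η + O(ε d)`, once the exploited arm is averaged over `x`: given weights and block, the arm has law
`x`, since `Round` moves it along a coupling. A change of arm contaminates the memory for up to `m`
rounds, but happens only after an exploration, which already costs `O(d)`. Hence the regret is at
most `O(d) + ℓ log ℓ / (ε (1 - exp (-η))) + T (η + O(ε d))`, and it remains to tune `ε` and `η`.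
-/

noncomputable section

namespace MemoryBandit

section Expectation

variable {α β : Type*} {p : PMF α}

lemma expect_eq_sum {S : Finset α} (hS : p.support ⊆ S) (φ : α → ℝ) :
    expect p φ = ∑ a ∈ S, (p a).toReal * φ a := by
  refine tsum_eq_sum fun a ha => ?_
  simp [(p.apply_eq_zero_iff a).2 fun h => ha (hS h)]

lemma expect_eq_sum_univ [Fintype α] (p : PMF α) (φ : α → ℝ) :
    expect p φ = ∑ a, (p a).toReal * φ a :=
  expect_eq_sum (by simp) φ

lemma expect_pure (a : α) (φ : α → ℝ) : expect (PMF.pure a) φ = φ a := by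
  rw [expect_eq_sum (S := {a}) (by simp)]
  simp

lemma expect_const (hp : p.support.Finite) (c : ℝ) : expect p (fun _ => c) = c := by
  have hS : p.support ⊆ hp.toFinset := by simp
  have hsum : ∑ a ∈ hp.toFinset, p a = 1 := by
    rw [← p.tsum_coe, tsum_eq_sum fun a ha => (p.apply_eq_zero_iff a).2 fun h => ha (hS h)]
  rw [expect_eq_sum hS, ← Finset.sum_mul, ← ENNReal.toReal_sum fun a _ => p.apply_ne_top a, hsum,
    ENNReal.toReal_one, one_mul]

lemma expect_add (hp : p.support.Finite) (φ ψ : α → ℝ) :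
    expect p (fun a => φ a + ψ a) = expect p φ + expect p ψ := by
  have hS : p.support ⊆ hp.toFinset := by simp
  simp only [expect_eq_sum hS, mul_add, Finset.sum_add_distrib]

lemma expect_mono (hp : p.support.Finite) {φ ψ : α → ℝ} (h : ∀ a ∈ p.support, φ a ≤ ψ a) :
    expect p φ ≤ expect p ψ := by
  have hS : p.support ⊆ hp.toFinset := by simp
  rw [expect_eq_sum hS, expect_eq_sum hS]
  exact Finset.sum_le_sum fun a ha =>
    mul_le_mul_of_nonneg_left (h a (hp.mem_toFinset.1 ha)) ENNReal.toReal_nonneg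

lemma expect_congr {φ ψ : α → ℝ} (h : ∀ a ∈ p.support, φ a = ψ a) :
    expect p φ = expect p ψ := by
  refine tsum_congr fun a => ?_
  by_cases ha : a ∈ p.support
  · rw [h a ha]
  · simp [(p.apply_eq_zero_iff a).2 ha]

lemma expect_le_of_forall_le (hp : p.support.Finite) {φ : α → ℝ} {c : ℝ}
    (h : ∀ a ∈ p.support, φ a ≤ c) : expect p φ ≤ c :=
  (expect_mono hp h).trans_eq (expect_const hp c)

lemma le_expect_of_forall_le (hp : p.support.Finite) {φ : α → ℝ} {c : ℝ}
    (h : ∀ a ∈ p.support, c ≤ φ a) : c ≤ expect p φ :=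
  (expect_const hp c).symm.trans_le (expect_mono hp h)

lemma finite_support_bind {f : α → PMF β} (hp : p.support.Finite)
    (hf : ∀ a, (f a).support.Finite) : (p.bind f).support.Finite := by
  rw [PMF.support_bind]
  exact hp.biUnion fun a _ => hf a

lemma finite_support_map (hp : p.support.Finite) (f : α → β) : (p.map f).support.Finite := by
  rw [PMF.support_map]
  exact hp.image f

lemma toReal_bind_apply {S : Finset α} (hS : p.support ⊆ S) (f : α → PMF β) (b : β) :
    (p.bind f b).toReal = ∑ a ∈ S, (p a).toReal * (f a b).toReal := by
  rw [PMF.bind_apply, tsum_eq_sum (s := S) fun a ha => ?_, ENNReal.toReal_sum fun a _ => ?_]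
  · simp only [ENNReal.toReal_mul]
  · exact ENNReal.mul_ne_top (p.apply_ne_top a) ((f a).apply_ne_top b)
  · rw [(p.apply_eq_zero_iff a).2 fun h => ha (hS h), zero_mul]

lemma expect_bind {f : α → PMF β} (hp : p.support.Finite) (hf : ∀ a, (f a).support.Finite)
    (φ : β → ℝ) : expect (p.bind f) φ = expect p fun a => expect (f a) φ := by
  have hb := finite_support_bind hp hf
  have hS : p.support ⊆ hp.toFinset := by simp
  have hfa : ∀ a ∈ hp.toFinset, (f a).support ⊆ hb.toFinset := by
    intro a ha b hbf
    rw [Set.Finite.coe_toFinset, PMF.support_bind]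
    exact Set.mem_biUnion (hp.mem_toFinset.1 ha) hbf
  calc expect (p.bind f) φ
      = ∑ b ∈ hb.toFinset, ∑ a ∈ hp.toFinset, (p a).toReal * ((f a b).toReal * φ b) := by
        rw [expect_eq_sum (S := hb.toFinset) (by simp)]
        simp only [toReal_bind_apply hS, Finset.sum_mul, mul_assoc]
    _ = ∑ a ∈ hp.toFinset, (p a).toReal * expect (f a) φ := by
        rw [Finset.sum_comm]
        exact Finset.sum_congr rfl fun a ha => by rw [expect_eq_sum (hfa a ha), Finset.mul_sum]
    _ = expect p fun a => expect (f a) φ := (expect_eq_sum hS _).symm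

lemma expect_map (hp : p.support.Finite) (f : α → β) (φ : β → ℝ) :
    expect (p.map f) φ = expect p fun a => φ (f a) := by
  rw [← PMF.bind_pure_comp, expect_bind hp fun a => by simp]
  simp only [Function.comp_apply, expect_pure]

lemma expect_uniformOfFintype [Fintype α] [Nonempty α] (φ : α → ℝ) :
    expect (PMF.uniformOfFintype α) φ = (Fintype.card α : ℝ)⁻¹ * ∑ a, φ a := by
  rw [expect_eq_sum_univ, Finset.mul_sum]
  simp

lemma expect_coin (ε : unitInterval) (φ : Bool → ℝ) :
    expect (coin ε) φ = ε * φ true + (1 - ε) * φ false := by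
  rw [expect_eq_sum_univ, Fintype.sum_bool]
  simp [coin, ENNReal.toReal_ofReal, ε.2.1, ε.2.2]

end Expectation

section Rounding

variable {ℓ : ℕ} {p q : Fin ℓ → ℝ}

/-- `τ` is a coupling of `p` and `q`, that is, a transport plan from `p` to `q` of any cost. -/
def IsCoupling (p q : Fin ℓ → ℝ) (τ : Fin ℓ → Fin ℓ → ℝ) : Prop :=
  (∀ i j, 0 ≤ τ i j) ∧ (∀ i, ∑ j, τ i j = p i) ∧ ∀ j, ∑ i, τ i j = q j

/-- A choice of a coupling of any two distributions on the arms. -/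
def IsCouplingRule (τ : (Fin ℓ → ℝ) → (Fin ℓ → ℝ) → Fin ℓ → Fin ℓ → ℝ) : Prop :=
  ∀ p ∈ stdSimplex ℝ (Fin ℓ), ∀ q ∈ stdSimplex ℝ (Fin ℓ), IsCoupling p q (τ p q)

lemma IsTransportRule.isCouplingRule {τ : (Fin ℓ → ℝ) → (Fin ℓ → ℝ) → Fin ℓ → Fin ℓ → ℝ}
    (hτ : IsTransportRule τ) : IsCouplingRule τ := fun p hp q hq =>
  let ⟨nonneg, row, col, _⟩ := hτ p hp q hq
  ⟨nonneg, row, col⟩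

lemma IsCoupling.mul_expect_round {τ : Fin ℓ → Fin ℓ → ℝ} (hτ : IsCoupling p q τ) (i : Fin ℓ)
    (φ : Fin ℓ → ℝ) : p i * expect (round p τ i) φ = ∑ j, τ i j * φ j := by
  obtain ⟨nonneg, row, -⟩ := hτ
  have hpi : 0 ≤ p i := row i ▸ Finset.sum_nonneg fun j _ => nonneg i j
  rcases hpi.eq_or_lt with hpi | hpi
  · have hτi : ∀ j, τ i j = 0 := fun j =>
      (Finset.sum_eq_zero_iff_of_nonneg fun j _ => nonneg i j).1 ((row i).trans hpi.symm) j
        (Finset.mem_univ j)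
    simp [← hpi, hτi]
  · rw [expect_eq_sum_univ, Finset.mul_sum]
    refine Finset.sum_congr rfl fun j _ => ?_
    rw [round, dif_pos ⟨hpi, nonneg i, row i⟩, PMF.ofFintype_apply,
      ENNReal.toReal_ofReal (div_nonneg (nonneg i j) hpi.le)]
    field_simp

lemma IsCoupling.dotProduct_expect_round {τ : Fin ℓ → Fin ℓ → ℝ} (hτ : IsCoupling p q τ)
    (φ : Fin ℓ → ℝ) : p ⬝ᵥ (fun i => expect (round p τ i) φ) = q ⬝ᵥ φ := by
  simp only [dotProduct, hτ.mul_expect_round]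
  rw [Finset.sum_comm]
  exact Finset.sum_congr rfl fun j _ => by rw [← Finset.sum_mul, hτ.2.2 j]

open Classical in
/-- The law of the exploited arm after feedback has changed the distribution from `p` to `q`, if it
was `i` before. -/
def updateArm (τ : (Fin ℓ → ℝ) → (Fin ℓ → ℝ) → Fin ℓ → Fin ℓ → ℝ) (p q : Fin ℓ → ℝ) (i : Fin ℓ) :
    PMF (Fin ℓ) :=
  if q ≠ p then round p (τ p q) i else PMF.pure i

lemma dotProduct_expect_updateArm {τ : (Fin ℓ → ℝ) → (Fin ℓ → ℝ) → Fin ℓ → Fin ℓ → ℝ}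
    (hτ : IsCoupling p q (τ p q)) (φ : Fin ℓ → ℝ) :
    p ⬝ᵥ (fun i => expect (updateArm τ p q i) φ) = q ⬝ᵥ φ := by
  unfold updateArm
  split_ifs with h
  · exact hτ.dotProduct_expect_round φ
  · simp only [expect_pure, not_not.1 h]

end Rounding

section Hedge

variable {ℓ : ℕ} {w : Fin ℓ → ℝ}

lemma hedgeUpdate_pos (hw : ∀ j, 0 < w j) (η : ℝ) (g : Fin ℓ → ℝ) (j : Fin ℓ) :
    0 < hedgeUpdate η w g j :=
  mul_pos (hw j) (Real.exp_pos _)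

lemma exp_neg_mul_le {c : ℝ} (hc : c ∈ Set.Icc (0 : ℝ) 1) (η : ℝ) :
    Real.exp (-η * c) ≤ 1 - (1 - Real.exp (-η)) * c := by
  have h := convexOn_exp.2 (Set.mem_univ (0 : ℝ)) (Set.mem_univ (-η))
    (sub_nonneg.2 hc.2) hc.1 (by ring)
  simp only [smul_eq_mul, mul_zero, zero_add, Real.exp_zero, mul_one] at h
  rw [mul_comm]
  linarith

lemma le_one_sub_exp_neg_mul_one_add (η : ℝ) : η ≤ (1 - Real.exp (-η)) * (1 + η) := by
  have h : Real.exp (-η) * (1 + η) ≤ Real.exp (-η) * Real.exp η :=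
    mul_le_mul_of_nonneg_left (by linarith [Real.add_one_le_exp η]) (Real.exp_pos _).le
  rw [← Real.exp_add, neg_add_cancel, Real.exp_zero] at h
  linarith

/-- The divergence `-log x(y)` of the HEDGE distribution `x` with weights `w` from the point mass at
`y`, which serves as the potential of HEDGE with respect to the comparator `y`. -/
def hedgePotential (y : Fin ℓ) (w : Fin ℓ → ℝ) : ℝ := -Real.log (hedgeDist w y)

lemma hedgePotential_one (y : Fin ℓ) : hedgePotential y (fun _ => 1) = Real.log ℓ := by
  simp [hedgePotential, hedgeDist]

variable [NeZero ℓ]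

lemma sum_weights_pos (hw : ∀ j, 0 < w j) : 0 < ∑ j, w j :=
  Finset.sum_pos (fun j _ => hw j) Finset.univ_nonempty

lemma hedgeDist_pos (hw : ∀ j, 0 < w j) (j : Fin ℓ) : 0 < hedgeDist w j :=
  div_pos (hw j) (sum_weights_pos hw)

lemma sum_hedgeDist (hw : ∀ j, 0 < w j) : ∑ j, hedgeDist w j = 1 := by
  simp only [hedgeDist, ← Finset.sum_div, div_self (sum_weights_pos hw).ne']

lemma hedgeDist_mem_stdSimplex (hw : ∀ j, 0 < w j) : hedgeDist w ∈ stdSimplex ℝ (Fin ℓ) :=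
  ⟨fun j => (hedgeDist_pos hw j).le, sum_hedgeDist hw⟩

lemma hedgeDist_dotProduct_const (hw : ∀ j, 0 < w j) (c : ℝ) :
    (hedgeDist w ⬝ᵥ fun _ => c) = c := by
  simp only [dotProduct, ← Finset.sum_mul, sum_hedgeDist hw, one_mul]

lemma hedgeDist_dotProduct_mem_Icc (hw : ∀ j, 0 < w j) {g : Fin ℓ → ℝ} {a b : ℝ}
    (hg : ∀ j, g j ∈ Set.Icc a b) : hedgeDist w ⬝ᵥ g ∈ Set.Icc a b := by
  constructor
  · rw [← hedgeDist_dotProduct_const hw a]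
    exact Finset.sum_le_sum fun j _ => mul_le_mul_of_nonneg_left (hg j).1 (hedgeDist_pos hw j).le
  · rw [← hedgeDist_dotProduct_const hw b]
    exact Finset.sum_le_sum fun j _ => mul_le_mul_of_nonneg_left (hg j).2 (hedgeDist_pos hw j).le

lemma hedgePotential_nonneg (hw : ∀ j, 0 < w j) (y : Fin ℓ) : 0 ≤ hedgePotential y w := by
  refine neg_nonneg.2 (Real.log_nonpos (hedgeDist_pos hw y).le ?_)
  rw [← sum_hedgeDist hw]
  exact Finset.single_le_sum (fun j _ => (hedgeDist_pos hw j).le) (Finset.mem_univ y)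

lemma sum_hedgeUpdate_le (hw : ∀ j, 0 < w j) (η : ℝ) {g : Fin ℓ → ℝ}
    (hg : ∀ j, g j ∈ Set.Icc (0 : ℝ) 1) :
    ∑ j, hedgeUpdate η w g j ≤
      (∑ j, w j) * Real.exp (-((1 - Real.exp (-η)) * (hedgeDist w ⬝ᵥ g))) := by
  have hW := sum_weights_pos hw
  calc ∑ j, hedgeUpdate η w g j
      ≤ ∑ j, w j * (1 - (1 - Real.exp (-η)) * g j) :=
        Finset.sum_le_sum fun j _ => mul_le_mul_of_nonneg_left (exp_neg_mul_le (hg j) η) (hw j).le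
    _ = (∑ j, w j) * (1 - (1 - Real.exp (-η)) * (hedgeDist w ⬝ᵥ g)) := by
        simp only [dotProduct, hedgeDist, mul_sub, mul_one, Finset.sum_sub_distrib, Finset.mul_sum]
        congr 1
        refine Finset.sum_congr rfl fun j _ => ?_
        field_simp
    _ ≤ _ := mul_le_mul_of_nonneg_left (Real.one_sub_le_exp_neg _) hW.le

lemma hedgePotential_hedgeUpdate_le (hw : ∀ j, 0 < w j) (η : ℝ) {g : Fin ℓ → ℝ}
    (hg : ∀ j, g j ∈ Set.Icc (0 : ℝ) 1) (y : Fin ℓ) :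
    hedgePotential y (hedgeUpdate η w g) ≤
      hedgePotential y w - (1 - Real.exp (-η)) * (hedgeDist w ⬝ᵥ g) + η * g y := by
  have hw' := hedgeUpdate_pos hw η g
  have hW := sum_weights_pos hw
  have hlog := Real.log_le_log (sum_weights_pos hw') (sum_hedgeUpdate_le hw η hg)
  rw [Real.log_mul hW.ne' (Real.exp_pos _).ne', Real.log_exp] at hlog
  have hy : Real.log (hedgeUpdate η w g y) = Real.log (w y) - η * g y := by
    rw [hedgeUpdate, Real.log_mul (hw y).ne' (Real.exp_pos _).ne', Real.log_exp]
    ring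
  rw [hedgePotential, hedgePotential, hedgeDist, hedgeDist,
    Real.log_div (hw' y).ne' (sum_weights_pos hw').ne', Real.log_div (hw y).ne' hW.ne', hy]
  linarith

lemma sum_hedgePotential_hedgeUpdate_single_le (hw : ∀ j, 0 < w j) {η : ℝ} (hη : 0 ≤ η)
    {c : Fin ℓ → ℝ} (hc : ∀ e, c e ∈ Set.Icc (0 : ℝ) 1) (y : Fin ℓ) :
    ∑ e, hedgePotential y (hedgeUpdate η w (Pi.single e (c e))) ≤
      ℓ * hedgePotential y w - (1 - Real.exp (-η)) * (hedgeDist w ⬝ᵥ c - c y - η) := by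
  have hsingle : ∀ e j, (Pi.single e (c e) : Fin ℓ → ℝ) j ∈ Set.Icc (0 : ℝ) 1 := fun e j => by
    rw [Pi.single_apply]
    split_ifs
    exacts [hc e, by simp]
  have hδ : 0 ≤ 1 - Real.exp (-η) := by simpa using hη
  have hrate : η * c y ≤ (1 - Real.exp (-η)) * (c y + η) :=
    calc η * c y ≤ (1 - Real.exp (-η)) * (1 + η) * c y :=
          mul_le_mul_of_nonneg_right (le_one_sub_exp_neg_mul_one_add η) (hc y).1
      _ = (1 - Real.exp (-η)) * (c y + η * c y) := by ring
      _ ≤ _ := by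
          gcongr
          exact mul_le_of_le_one_right hη (hc y).2
  calc ∑ e, hedgePotential y (hedgeUpdate η w (Pi.single e (c e)))
      ≤ ∑ e, (hedgePotential y w - (1 - Real.exp (-η)) * (hedgeDist w e * c e) +
          η * (Pi.single e (c e) : Fin ℓ → ℝ) y) :=
        Finset.sum_le_sum fun e _ => by
          simpa only [dotProduct_single] using hedgePotential_hedgeUpdate_le hw η (hsingle e) y
    _ = ℓ * hedgePotential y w - (1 - Real.exp (-η)) * (hedgeDist w ⬝ᵥ c) + η * c y := by
        rw [Finset.sum_add_distrib, Finset.sum_sub_distrib, ← Finset.mul_sum, ← Finset.mul_sum,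
          Finset.sum_pi_single]
        simp [dotProduct]
    _ ≤ _ := by linarith

end Hedge

section Adversary

variable {ℓ : ℕ} (A : Adversary ℓ)

/-- The loss of round `t` under constant play: the arm `y` has been played since the start. -/
def Adversary.constLoss (t : ℕ) (y : Fin ℓ) : ℝ := A.loss (List.replicate t y)

lemma Adversary.constLoss_mem (t : ℕ) (y : Fin ℓ) : A.constLoss t y ∈ Set.Icc (0 : ℝ) 1 :=
  A.loss_mem _

lemma Adversary.totalLoss_replicate_succ (t : ℕ) (y : Fin ℓ) :
    A.totalLoss (List.replicate (t + 1) y) =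
      A.constLoss (t + 1) y + A.totalLoss (List.replicate t y) :=
  rfl

lemma Adversary.totalLoss_nonneg (h : History ℓ) : 0 ≤ A.totalLoss h := by
  induction h with
  | nil => exact le_rfl
  | cons a h ih => exact add_nonneg (A.loss_mem _).1 ih

lemma Adversary.totalLoss_le_length (h : History ℓ) : A.totalLoss h ≤ h.length := by
  induction h with
  | nil => simp [Adversary.totalLoss]
  | cons a h ih =>
    rw [Adversary.totalLoss, List.length_cons]
    push_cast
    linarith [(A.loss_mem (a :: h)).2]

lemma Adversary.MemoryBounded.loss_cons {A : Adversary ℓ} {m : ℕ} (hA : A.MemoryBounded m)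
    {h : History ℓ} {a : Fin ℓ} (hh : ∀ b ∈ h.take m, b = a) :
    A.loss (a :: h) = A.constLoss (h.length + 1) a := by
  refine hA _ _ (by simp) ?_
  rw [List.replicate_succ, List.take_succ_cons, List.take_succ_cons, List.take_replicate,
    List.eq_replicate_of_mem hh, List.length_take]

/-- The number of further rounds in which `i` must be played until the last `m` actions are all
`i`. -/
def contamination (m : ℕ) (i : Fin ℓ) (h : History ℓ) : ℕ := m - (h.takeWhile (· = i)).length

lemma contamination_le (m : ℕ) (i : Fin ℓ) (h : History ℓ) : contamination m i h ≤ m :=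
  Nat.sub_le _ _

lemma contamination_cons_self (m : ℕ) (i : Fin ℓ) (h : History ℓ) :
    contamination m i (i :: h) = contamination m i h - 1 := by
  simp [contamination, Nat.sub_sub]

lemma eq_of_mem_take_of_contamination_eq_zero {m : ℕ} {i : Fin ℓ} {h : History ℓ}
    (h0 : contamination m i h = 0) : ∀ a ∈ h.take m, a = i := by
  intro a ha
  have hpre : h.take m <+: h.takeWhile (· = i) :=
    List.prefix_of_prefix_length_le (List.take_prefix m h) (List.takeWhile_prefix _)
      ((List.length_take_le m h).trans (Nat.sub_eq_zero_iff_le.1 h0))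
  simpa using List.mem_takeWhile_imp (hpre.subset ha)

lemma Adversary.MemoryBounded.loss_add_contamination_le {A : Adversary ℓ} {m : ℕ}
    (hA : A.MemoryBounded m) (i : Fin ℓ) (h : History ℓ) :
    A.loss (i :: h) + contamination m i (i :: h) ≤
      A.constLoss (h.length + 1) i + contamination m i h := by
  rw [contamination_cons_self]
  rcases Nat.eq_zero_or_pos (contamination m i h) with h0 | hpos
  · rw [hA.loss_cons (eq_of_mem_take_of_contamination_eq_zero h0), h0]
  · rw [Nat.cast_pred hpos]
    linarith [(A.loss_mem (i :: h)).2, (A.constLoss_mem (h.length + 1) i).1]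

/-- The expected regret in round `t`, with respect to `y`, of an arm drawn from the HEDGE
distribution with weights `w`, when losses are those of constant play. -/
def Adversary.hedgeRegret (y : Fin ℓ) (t : ℕ) (w : Fin ℓ → ℝ) : ℝ :=
  hedgeDist w ⬝ᵥ A.constLoss t - A.constLoss t y

/-- The regret of HEDGE with fixed weights `w` in the rounds `t + 1, …, t + d`. -/
def Adversary.windowRegret (y : Fin ℓ) (d t : ℕ) (w : Fin ℓ → ℝ) : ℝ :=
  ∑ j ∈ Finset.range d, A.hedgeRegret y (t + 1 + j) w

lemma Adversary.windowRegret_succ (y : Fin ℓ) (d t : ℕ) (w : Fin ℓ → ℝ) :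
    A.windowRegret y d (t + 1) w =
      A.windowRegret y d t w + A.hedgeRegret y (t + 1 + d) w - A.hedgeRegret y (t + 1) w := by
  simp only [windowRegret]
  rw [← Finset.sum_range_succ, Finset.sum_range_succ', add_zero, add_sub_cancel_right]
  exact Finset.sum_congr rfl fun j _ => by rw [add_right_comm, ← add_assoc]

variable [NeZero ℓ]

lemma Adversary.abs_hedgeRegret_le (y : Fin ℓ) (t : ℕ) {w : Fin ℓ → ℝ} (hw : ∀ j, 0 < w j) :
    |A.hedgeRegret y t w| ≤ 1 := by
  have hmean := hedgeDist_dotProduct_mem_Icc hw (A.constLoss_mem t)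
  have hy := A.constLoss_mem t y
  rw [hedgeRegret, abs_le]
  exact ⟨by linarith [hmean.1, hy.2], by linarith [hmean.2, hy.1]⟩

lemma Adversary.abs_windowRegret_le (y : Fin ℓ) (d t : ℕ) {w : Fin ℓ → ℝ} (hw : ∀ j, 0 < w j) :
    |A.windowRegret y d t w| ≤ d := by
  calc |A.windowRegret y d t w|
      ≤ ∑ j ∈ Finset.range d, |A.hedgeRegret y (t + 1 + j) w| := Finset.abs_sum_le_sum_abs _ _
    _ ≤ ∑ _j ∈ Finset.range d, 1 := Finset.sum_le_sum fun j _ => A.abs_hedgeRegret_le y _ hw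
    _ = d := by simp

end Adversary

section Run

variable {ℓ : ℕ} {A : Adversary ℓ} {ε : unitInterval} {η : ℝ} {m d : ℕ}
  {τ : (Fin ℓ → ℝ) → (Fin ℓ → ℝ) → Fin ℓ → Fin ℓ → ℝ} {t : ℕ}

/-- What holds in every reachable state after `t` rounds: the weights are positive, and while the
last `k` of the `d` rounds of bootstrapping `e` are to come, the last `d - k` actions are `e`. -/
structure State.Valid (d t : ℕ) (s : State ℓ) : Prop where
  length_hist : s.hist.length = t
  weights_pos : ∀ j, 0 < s.w j
  block : ∀ e k, s.block = some (e, k) → 1 ≤ k ∧ k ≤ d ∧ ∀ a ∈ s.hist.take (d - k), a = e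

/-- The weights of HEDGE after the exploration of arm `e` in round `t`, if the loss is that of
constant play. -/
def Adversary.explore (A : Adversary ℓ) (η : ℝ) (t : ℕ) (e : Fin ℓ) (w : Fin ℓ → ℝ) : Fin ℓ → ℝ :=
  hedgeUpdate η w (Pi.single e (A.constLoss t e))

variable [NeZero ℓ]

section Step

variable (A ε η d τ) (w : Fin ℓ → ℝ) (i e : Fin ℓ) (h : History ℓ) (φ : State ℓ → ℝ)

lemma finite_support_step (s : State ℓ) : (step A ε η d τ s).support.Finite := by
  unfold step
  split
  · refine finite_support_bind (Set.toFinite _) fun β => ?_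
    cases β
    · simp
    · exact finite_support_map (Set.toFinite _) _
  · split_ifs
    · simp
    · exact finite_support_map (Set.toFinite _) _

lemma expect_step_none :
    expect (step A ε η d τ ⟨w, i, none, h⟩) φ =
      ε * ((ℓ : ℝ)⁻¹ * ∑ e, φ ⟨w, i, some (e, d), i :: h⟩) +
        (1 - ε) * φ ⟨w, i, none, i :: h⟩ := by
  rw [step, expect_bind (Set.toFinite _), expect_coin, if_pos rfl, if_neg Bool.false_ne_true,
    expect_pure, expect_map (Set.toFinite _), expect_uniformOfFintype, Fintype.card_fin]
  intro β
  cases β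
  · simp
  · exact finite_support_map (Set.toFinite _) _

lemma expect_step_some_of_one_lt {k : ℕ} (hk : 1 < k) :
    expect (step A ε η d τ ⟨w, i, some (e, k), h⟩) φ =
      φ ⟨w, i, some (e, k - 1), e :: h⟩ := by
  simp only [step, if_pos hk, expect_pure]

lemma Adversary.MemoryBounded.expect_step_some_one {A : Adversary ℓ} (hA : A.MemoryBounded m)
    {h : History ℓ} (hh : ∀ a ∈ h.take m, a = e) :
    expect (step A ε η d τ ⟨w, i, some (e, 1), h⟩) φ =
      expect (updateArm τ (hedgeDist w) (hedgeDist (A.explore η (h.length + 1) e w)) i)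
        fun i' => φ ⟨A.explore η (h.length + 1) e w, i', none, e :: h⟩ := by
  have hfeedback : (fun j => if j = e then A.loss (e :: h) else 0) =
      Pi.single e (A.constLoss (h.length + 1) e) := by
    ext j
    rw [Pi.single_apply, hA.loss_cons hh]
  rw [step]
  dsimp only
  rw [if_neg (lt_irrefl 1), expect_map (Set.toFinite _), hfeedback]
  rfl

end Step

lemma State.Valid.of_mem_support_step (hd : 1 ≤ d) {s s' : State ℓ} (hs : s.Valid d t)
    (hs' : s' ∈ (step A ε η d τ s).support) : s'.Valid d (t + 1) := by
  obtain ⟨w, i, b, h⟩ := s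
  obtain ⟨hlen, hw, hblock⟩ := hs
  dsimp only at hlen hw hblock
  rcases b with _ | ⟨e, k⟩
  · rw [step, PMF.mem_support_bind_iff] at hs'
    obtain ⟨β, -, hs'⟩ := hs'
    cases β
    · rw [if_neg Bool.false_ne_true, PMF.mem_support_pure_iff] at hs'
      subst hs'
      exact ⟨by simp [hlen], hw, by simp⟩
    · rw [if_pos rfl, PMF.mem_support_map_iff] at hs'
      obtain ⟨e, -, rfl⟩ := hs'
      refine ⟨by simp [hlen], hw, fun e' k hk => ?_⟩
      obtain ⟨rfl, rfl⟩ : e = e' ∧ d = k := by simpa using hk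
      exact ⟨hd, le_rfl, by simp⟩
  · obtain ⟨hk1, hkd, hh⟩ := hblock e k rfl
    rw [step] at hs'
    dsimp only at hs'
    by_cases hk : 1 < k
    · rw [if_pos hk, PMF.mem_support_pure_iff] at hs'
      subst hs'
      refine ⟨by simp [hlen], hw, fun e' k' hk' => ?_⟩
      obtain ⟨rfl, rfl⟩ : e = e' ∧ k - 1 = k' := by simpa using hk'
      refine ⟨by omega, by omega, ?_⟩
      rw [show d - (k - 1) = (d - k) + 1 by omega, List.take_succ_cons]
      exact List.forall_mem_cons.2 ⟨rfl, hh⟩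
    · rw [if_neg hk, PMF.mem_support_map_iff] at hs'
      obtain ⟨i', -, rfl⟩ := hs'
      exact ⟨by simp [hlen], hedgeUpdate_pos hw _ _, by simp⟩

lemma valid_of_mem_support_run (hd : 1 ≤ d) {s : State ℓ} (hs : s ∈ (run A ε η d τ t).support) :
    s.Valid d t := by
  induction t generalizing s with
  | zero =>
    rw [run, init, PMF.mem_support_map_iff] at hs
    obtain ⟨i, -, rfl⟩ := hs
    exact ⟨rfl, fun _ => one_pos, by simp⟩
  | succ t ih =>
    rw [run, PMF.mem_support_bind_iff] at hs
    obtain ⟨r, hr, hs⟩ := hs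
    exact (ih hr).of_mem_support_step hd hs

lemma length_of_mem_support_play (hd : 1 ≤ d) {T : ℕ} {h : History ℓ}
    (hh : h ∈ (play A ε η d τ T).support) : h.length = T := by
  rw [play, PMF.mem_support_map_iff] at hh
  obtain ⟨s, hs, rfl⟩ := hh
  exact (valid_of_mem_support_run hd hs).length_hist

variable (A ε η d τ t)

lemma finite_support_run : (run A ε η d τ t).support.Finite := by
  induction t with
  | zero => exact finite_support_map (Set.toFinite _) _
  | succ t ih => exact finite_support_bind ih (finite_support_step A ε η d τ)

lemma expect_run_zero (φ : State ℓ → ℝ) :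
    expect (run A ε η d τ 0) φ = (ℓ : ℝ)⁻¹ * ∑ i, φ ⟨fun _ => 1, i, none, []⟩ := by
  rw [run, init, expect_map (Set.toFinite _), expect_uniformOfFintype, Fintype.card_fin]

lemma expect_run_succ (φ : State ℓ → ℝ) :
    expect (run A ε η d τ (t + 1)) φ =
      expect (run A ε η d τ t) fun s => expect (step A ε η d τ s) φ :=
  expect_bind (finite_support_run A ε η d τ t) (finite_support_step A ε η d τ) φ

end Run

section ExploitedArm

variable {ℓ : ℕ} [NeZero ℓ] {A : Adversary ℓ} {m d : ℕ}
  {τ : (Fin ℓ → ℝ) → (Fin ℓ → ℝ) → Fin ℓ → Fin ℓ → ℝ}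

/-- The expectation of `G w b i` after round `t + 1`, given the weights, the block and the exploited
arm before that round. The history is irrelevant for it, because feedback is given only after `d`
constant actions. -/
def transition (A : Adversary ℓ) (ε : unitInterval) (η : ℝ) (d : ℕ)
    (τ : (Fin ℓ → ℝ) → (Fin ℓ → ℝ) → Fin ℓ → Fin ℓ → ℝ) (t : ℕ)
    (G : (Fin ℓ → ℝ) → Option (Fin ℓ × ℕ) → Fin ℓ → ℝ) (w : Fin ℓ → ℝ) :
    Option (Fin ℓ × ℕ) → Fin ℓ → ℝ
  | none, i => ε * ((ℓ : ℝ)⁻¹ * ∑ e, G w (some (e, d)) i) + (1 - ε) * G w none i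
  | some (e, k), i =>
    if 1 < k then G w (some (e, k - 1)) i
    else expect (updateArm τ (hedgeDist w) (hedgeDist (A.explore η (t + 1) e w)) i)
      (G (A.explore η (t + 1) e w) none)

lemma State.Valid.expect_step_eq_transition (hA : A.MemoryBounded m) (hd : m < d)
    (ε : unitInterval) (η : ℝ) (τ : (Fin ℓ → ℝ) → (Fin ℓ → ℝ) → Fin ℓ → Fin ℓ → ℝ) {t : ℕ}
    {s : State ℓ} (hs : s.Valid d t) (G : (Fin ℓ → ℝ) → Option (Fin ℓ × ℕ) → Fin ℓ → ℝ) :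
    expect (step A ε η d τ s) (fun s => G s.w s.block s.i) =
      transition A ε η d τ t G s.w s.block s.i := by
  obtain ⟨w, i, b, h⟩ := s
  obtain rfl : h.length = t := hs.length_hist
  rcases b with _ | ⟨e, k⟩
  · rw [expect_step_none]
    rfl
  · obtain ⟨hk1, -, hh⟩ := hs.block e k rfl
    rcases hk1.eq_or_lt with rfl | hk
    · rw [hA.expect_step_some_one ε η d τ w i e _ fun a ha =>
        hh a ((List.take_sublist_take_left (by omega)).subset ha)]
      simp [transition]
    · rw [expect_step_some_of_one_lt A ε η d τ w i e h _ hk]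
      simp [transition, hk]

lemma hedgeDist_dotProduct_transition (A : Adversary ℓ) (ε : unitInterval) (η : ℝ) (d : ℕ)
    (hτ : IsCouplingRule τ) (t : ℕ) (G : (Fin ℓ → ℝ) → Option (Fin ℓ × ℕ) → Fin ℓ → ℝ)
    {w : Fin ℓ → ℝ} (hw : ∀ j, 0 < w j) (b : Option (Fin ℓ × ℕ)) :
    hedgeDist w ⬝ᵥ transition A ε η d τ t (fun w b _ => hedgeDist w ⬝ᵥ G w b) w b =
      hedgeDist w ⬝ᵥ transition A ε η d τ t G w b := by
  rcases b with _ | ⟨e, k⟩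
  · have hsplit : transition A ε η d τ t G w none =
        (ε : ℝ) • (ℓ : ℝ)⁻¹ • ∑ e, G w (some (e, d)) + (1 - (ε : ℝ)) • G w none := by
      ext i
      simp [transition]
    simp only [hsplit, dotProduct_add, dotProduct_smul, dotProduct_sum, smul_eq_mul]
    exact hedgeDist_dotProduct_const hw _
  · by_cases hk : 1 < k
    · have hstep : ∀ G, transition A ε η d τ t G w (some (e, k)) = G w (some (e, k - 1)) :=
        fun G => funext fun i => if_pos hk
      rw [hstep, hstep]
      exact hedgeDist_dotProduct_const hw _
    · have hw' : ∀ j, 0 < A.explore η (t + 1) e w j := hedgeUpdate_pos hw _ _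
      have hcoupling := hτ _ (hedgeDist_mem_stdSimplex hw) _ (hedgeDist_mem_stdSimplex hw')
      have hstep : ∀ G, transition A ε η d τ t G w (some (e, k)) = fun i =>
          expect (updateArm τ (hedgeDist w) (hedgeDist (A.explore η (t + 1) e w)) i)
            (G (A.explore η (t + 1) e w) none) :=
        fun G => funext fun i => if_neg hk
      rw [hstep, hstep, dotProduct_expect_updateArm hcoupling,
        dotProduct_expect_updateArm hcoupling, hedgeDist_dotProduct_const hw']

/-- In terms of test functions `G`: given the weights and the block, the exploited arm has the law
`hedgeDist s.w`. -/
lemma expect_run_eq_expect_hedgeDist (hA : A.MemoryBounded m) (hd : m < d) (ε : unitInterval)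
    (η : ℝ) (hτ : IsCouplingRule τ) (t : ℕ)
    (G : (Fin ℓ → ℝ) → Option (Fin ℓ × ℕ) → Fin ℓ → ℝ) :
    expect (run A ε η d τ t) (fun s => G s.w s.block s.i) =
      expect (run A ε η d τ t) fun s => hedgeDist s.w ⬝ᵥ G s.w s.block := by
  induction t generalizing G with
  | zero =>
    have hℓ : (ℓ : ℝ) ≠ 0 := NeZero.ne _
    simp [expect_run_zero, dotProduct, hedgeDist, Finset.mul_sum, hℓ]
  | succ t ih =>
    have hsucc : ∀ G : (Fin ℓ → ℝ) → Option (Fin ℓ × ℕ) → Fin ℓ → ℝ,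
        expect (run A ε η d τ (t + 1)) (fun s => G s.w s.block s.i) =
          expect (run A ε η d τ t)
            fun s => hedgeDist s.w ⬝ᵥ transition A ε η d τ t G s.w s.block := by
      intro G
      rw [expect_run_succ, ← ih]
      exact expect_congr fun s hs =>
        (valid_of_mem_support_run (by omega) hs).expect_step_eq_transition hA hd ε η τ G
    rw [hsucc, hsucc fun w b _ => hedgeDist w ⬝ᵥ G w b]
    exact expect_congr fun s hs => (hedgeDist_dotProduct_transition A ε η d hτ t G
      (valid_of_mem_support_run (by omega) hs).weights_pos s.block).symm

end ExploitedArm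

section Potential

variable {ℓ : ℕ} {A : Adversary ℓ} {ε : unitInterval} {η B : ℝ} {m d : ℕ}
  {τ : (Fin ℓ → ℝ) → (Fin ℓ → ℝ) → Fin ℓ → Fin ℓ → ℝ}

/-- A potential for the regret with respect to `y` after `t` rounds, which charges `B` for a unit of
the potential of HEDGE. During an exploration it anticipates the feedback,
pays for the remaining `k` rounds, and saves `2 * d` for the contamination and the window regret at
the next exploitation round. -/
def potential (A : Adversary ℓ) (η B : ℝ) (m d : ℕ) (y : Fin ℓ) (t : ℕ) (s : State ℓ) : ℝ :=
  match s.block with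
  | none =>
    contamination m s.i s.hist + A.windowRegret y d t s.w + B * hedgePotential y s.w
  | some (e, k) => 2 * d + k + B * hedgePotential y (A.explore η (t + k) e s.w)

/-- A bound for the expected increase of total loss plus potential in round `t + 1`, which depends
on the history only through the weights, the block and the exploited arm. -/
def driftBound (A : Adversary ℓ) (ε : unitInterval) (η : ℝ) (d : ℕ) (y : Fin ℓ) (t : ℕ)
    (w : Fin ℓ → ℝ) : Option (Fin ℓ × ℕ) → Fin ℓ → ℝ
  | none, i => A.constLoss (t + 1) i - A.hedgeRegret y (t + 1) w + (η + ε * (4 * d + 3))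
  | some _, _ => 0

variable [NeZero ℓ]

lemma mean_hedgePotential_explore_le (hη : 0 ≤ η) (hB0 : 0 ≤ B)
    (hB : ε * B * (1 - Real.exp (-η)) = ℓ) (A : Adversary ℓ) (y : Fin ℓ) (t : ℕ)
    {w : Fin ℓ → ℝ} (hw : ∀ j, 0 < w j) :
    ε * ((ℓ : ℝ)⁻¹ * ∑ e, B * hedgePotential y (A.explore η t e w)) ≤
      ε * (B * hedgePotential y w) - A.hedgeRegret y t w + η := by
  have hℓ : (ℓ : ℝ) ≠ 0 := NeZero.ne _
  have hscale : 0 ≤ ε * B / ℓ := div_nonneg (mul_nonneg ε.2.1 hB0) (Nat.cast_nonneg ℓ)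
  have hunit : ε * B / ℓ * (1 - Real.exp (-η)) = 1 := by
    rw [div_mul_eq_mul_div, hB, div_self hℓ]
  calc ε * ((ℓ : ℝ)⁻¹ * ∑ e, B * hedgePotential y (A.explore η t e w))
      = ε * B / ℓ * ∑ e, hedgePotential y (A.explore η t e w) := by
        rw [← Finset.mul_sum]
        ring
    _ ≤ ε * B / ℓ *
          (ℓ * hedgePotential y w - (1 - Real.exp (-η)) * (A.hedgeRegret y t w - η)) :=
        mul_le_mul_of_nonneg_left
          (sum_hedgePotential_hedgeUpdate_single_le hw hη (A.constLoss_mem t) y) hscale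
    _ = ε * B / ℓ * ℓ * hedgePotential y w -
          ε * B / ℓ * (1 - Real.exp (-η)) * (A.hedgeRegret y t w - η) := by ring
    _ = ε * (B * hedgePotential y w) - A.hedgeRegret y t w + η := by
        rw [hunit, div_mul_cancel₀ _ hℓ]
        ring

lemma expect_step_none_potential_le (hA : A.MemoryBounded m) (hη : 0 ≤ η) (hB0 : 0 ≤ B)
    (hB : ε * B * (1 - Real.exp (-η)) = ℓ)
    (τ : (Fin ℓ → ℝ) → (Fin ℓ → ℝ) → Fin ℓ → Fin ℓ → ℝ) (y : Fin ℓ) {w : Fin ℓ → ℝ}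
    (hw : ∀ j, 0 < w j) (i : Fin ℓ) (h : History ℓ) :
    expect (step A ε η d τ ⟨w, i, none, h⟩)
        (fun s => A.totalLoss s.hist + potential A η B m d y (h.length + 1) s) ≤
      A.totalLoss h + potential A η B m d y h.length ⟨w, i, none, h⟩ +
        driftBound A ε η d y h.length w none i := by
  set t := h.length
  have hℓ : (ℓ : ℝ) ≠ 0 := NeZero.ne _
  have hmean := mean_hedgePotential_explore_le hη hB0 hB A y (t + 1 + d) hw
  have hexplore : ε * ((ℓ : ℝ)⁻¹ * ∑ e, (A.totalLoss (i :: h) +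
        (2 * d + d + B * hedgePotential y (A.explore η (t + 1 + d) e w)))) ≤
      ε * (A.totalLoss (i :: h) + 3 * d + B * hedgePotential y w) -
        A.hedgeRegret y (t + 1 + d) w + η := by
    simp only [← add_assoc]
    rw [Finset.sum_add_distrib, Finset.sum_const, Finset.card_univ, Fintype.card_fin,
      nsmul_eq_mul, mul_add (ℓ : ℝ)⁻¹, inv_mul_cancel_left₀ hℓ]
    linarith
  have hexploit : A.loss (i :: h) + contamination m i (i :: h) + A.windowRegret y d (t + 1) w ≤
      A.constLoss (t + 1) i + contamination m i h + A.windowRegret y d t w +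
        A.hedgeRegret y (t + 1 + d) w - A.hedgeRegret y (t + 1) w := by
    linarith [hA.loss_add_contamination_le i h, A.windowRegret_succ y d t w]
  have hcost : A.loss (i :: h) + 3 * d - (A.constLoss (t + 1) i + contamination m i h +
      A.windowRegret y d t w + A.hedgeRegret y (t + 1 + d) w - A.hedgeRegret y (t + 1) w) ≤
      4 * d + 3 := by
    linarith [(A.loss_mem (i :: h)).2, (A.constLoss_mem (t + 1) i).1,
      Nat.cast_nonneg (α := ℝ) (contamination m i h),
      (abs_le.1 (A.abs_windowRegret_le y d t hw)).1,
      (abs_le.1 (A.abs_hedgeRegret_le y (t + 1 + d) hw)).1,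
      (abs_le.1 (A.abs_hedgeRegret_le y (t + 1) hw)).2]
  have hexploit' := mul_le_mul_of_nonneg_left hexploit (sub_nonneg.2 ε.2.2)
  have hcost' := mul_le_mul_of_nonneg_left hcost ε.2.1
  rw [expect_step_none]
  simp only [potential, driftBound]
  rw [Adversary.totalLoss] at hexplore ⊢
  linarith

lemma expect_step_some_potential_le (hA : A.MemoryBounded m) (hd : m < d) (ε : unitInterval)
    (η B : ℝ) (τ : (Fin ℓ → ℝ) → (Fin ℓ → ℝ) → Fin ℓ → Fin ℓ → ℝ) (y : Fin ℓ) {w : Fin ℓ → ℝ}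
    (i e : Fin ℓ) {k : ℕ} {h : History ℓ} (hs : State.Valid d h.length ⟨w, i, some (e, k), h⟩) :
    expect (step A ε η d τ ⟨w, i, some (e, k), h⟩)
        (fun s => A.totalLoss s.hist + potential A η B m d y (h.length + 1) s) ≤
      A.totalLoss h + potential A η B m d y h.length ⟨w, i, some (e, k), h⟩ := by
  obtain ⟨hk1, -, hh⟩ := hs.block e k rfl
  have hloss := (A.loss_mem (e :: h)).2
  rcases hk1.eq_or_lt with rfl | hk
  · rw [hA.expect_step_some_one ε η d τ w i e _ fun a ha =>
      hh a ((List.take_sublist_take_left (by omega)).subset ha)]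
    refine expect_le_of_forall_le (Set.toFinite _) fun i' _ => ?_
    have hwindow := (abs_le.1 (A.abs_windowRegret_le y d (h.length + 1)
      (w := A.explore η (h.length + 1) e w) (hedgeUpdate_pos hs.weights_pos _ _))).2
    have hcont : (contamination m i' (e :: h) : ℝ) ≤ d := by
      exact_mod_cast (contamination_le m i' (e :: h)).trans hd.le
    simp only [potential, Adversary.totalLoss, Nat.cast_one]
    linarith
  · rw [expect_step_some_of_one_lt A ε η d τ w i e h _ hk]
    simp only [potential, Adversary.totalLoss]
    rw [show h.length + 1 + (k - 1) = h.length + k by omega, Nat.cast_pred hk1]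
    linarith

lemma State.Valid.expect_step_potential_le (hA : A.MemoryBounded m) (hd : m < d) (hη : 0 ≤ η)
    (hB0 : 0 ≤ B) (hB : ε * B * (1 - Real.exp (-η)) = ℓ)
    (τ : (Fin ℓ → ℝ) → (Fin ℓ → ℝ) → Fin ℓ → Fin ℓ → ℝ) (y : Fin ℓ) {t : ℕ} {s : State ℓ}
    (hs : s.Valid d t) :
    expect (step A ε η d τ s)
        (fun s' => A.totalLoss s'.hist + potential A η B m d y (t + 1) s') ≤
      A.totalLoss s.hist + potential A η B m d y t s +
        driftBound A ε η d y t s.w s.block s.i := by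
  obtain ⟨w, i, _ | ⟨e, k⟩, h⟩ := s <;> obtain rfl : h.length = t := hs.length_hist
  · exact expect_step_none_potential_le hA hη hB0 hB τ y hs.weights_pos i h
  · rw [driftBound, add_zero]
    exact expect_step_some_potential_le hA hd ε η B τ y i e hs

lemma State.Valid.neg_le_potential (hB0 : 0 ≤ B) (A : Adversary ℓ) (η : ℝ) (m : ℕ) (y : Fin ℓ)
    {t : ℕ} {s : State ℓ} (hs : s.Valid d t) : -(d : ℝ) ≤ potential A η B m d y t s := by
  have hw := hs.weights_pos
  rw [potential]
  split
  · linarith [(abs_le.1 (A.abs_windowRegret_le y d t hw)).1,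
      mul_nonneg hB0 (hedgePotential_nonneg hw y),
      Nat.cast_nonneg (α := ℝ) (contamination m s.i s.hist)]
  · next e k _ =>
    linarith [mul_nonneg hB0 (hedgePotential_nonneg
        (w := A.explore η (t + k) e s.w) (hedgeUpdate_pos hw _ _) y),
      Nat.cast_nonneg (α := ℝ) d, Nat.cast_nonneg (α := ℝ) k]

lemma expect_driftBound_le (hA : A.MemoryBounded m) (hd : m < d) (ε : unitInterval)
    (hη : 0 ≤ η) (hτ : IsCouplingRule τ) (y : Fin ℓ) (t : ℕ) :
    expect (run A ε η d τ t) (fun s => driftBound A ε η d y t s.w s.block s.i) ≤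
      A.constLoss (t + 1) y + (η + ε * (4 * d + 3)) := by
  rw [expect_run_eq_expect_hedgeDist hA hd ε η hτ t (driftBound A ε η d y t)]
  refine expect_le_of_forall_le (finite_support_run A ε η d τ t) fun s hs => ?_
  have hw := (valid_of_mem_support_run (by omega) hs).weights_pos
  cases s.block with
  | none =>
    have hsplit : driftBound A ε η d y t s.w none = A.constLoss (t + 1) +
        fun _ => -A.hedgeRegret y (t + 1) s.w + (η + ε * (4 * d + 3)) := by
      ext i
      simp only [driftBound, Pi.add_apply]
      ring
    rw [hsplit, dotProduct_add, hedgeDist_dotProduct_const hw, Adversary.hedgeRegret]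
    linarith
  | some b =>
    have hzero : driftBound A ε η d y t s.w (some b) = 0 := rfl
    rw [hzero, dotProduct_zero]
    exact add_nonneg (A.constLoss_mem (t + 1) y).1
      (add_nonneg hη (mul_nonneg ε.2.1 (by positivity)))

lemma expect_run_potential_le (hA : A.MemoryBounded m) (hd : m < d) (hη : 0 ≤ η) (hB0 : 0 ≤ B)
    (hB : ε * B * (1 - Real.exp (-η)) = ℓ) (hτ : IsCouplingRule τ) (y : Fin ℓ) (t : ℕ) :
    expect (run A ε η d τ t) (fun s => A.totalLoss s.hist + potential A η B m d y t s) ≤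
      A.totalLoss (List.replicate t y) + 2 * d + B * Real.log ℓ +
        t * (η + ε * (4 * d + 3)) := by
  induction t with
  | zero =>
    rw [run, init, expect_map (Set.toFinite _)]
    refine expect_le_of_forall_le (Set.toFinite _) fun i _ => ?_
    have hwindow := (abs_le.1 (A.abs_windowRegret_le y d 0 (w := fun _ => 1) fun _ => one_pos)).2
    have hcont : (contamination m i [] : ℝ) ≤ d := by
      exact_mod_cast (contamination_le m i []).trans hd.le
    simp only [potential, hedgePotential_one, List.replicate_zero, Adversary.totalLoss,
      Nat.cast_zero]
    linarith
  | succ t ih =>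
    have hfin := finite_support_run A ε η d τ t
    rw [expect_run_succ, A.totalLoss_replicate_succ]
    refine (expect_mono hfin fun s hs =>
      (valid_of_mem_support_run (by omega) hs).expect_step_potential_le
        hA hd hη hB0 hB τ y).trans ?_
    rw [expect_add hfin]
    push_cast
    linarith [expect_driftBound_le hA hd ε hη hτ y t]

end Potential

section Regret

variable {ℓ : ℕ} [NeZero ℓ] {A : Adversary ℓ} {T : ℕ}

lemma policyRegret_le_of_forall {p : PMF (History ℓ)} {c : ℝ}
    (h : ∀ y, expect p A.totalLoss ≤ A.totalLoss (List.replicate T y) + c) :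
    policyRegret A T p ≤ c := by
  rw [policyRegret, sub_le_comm]
  exact Finset.le_inf' _ _ fun y _ => by linarith [h y]

lemma policyRegret_le_horizon (A : Adversary ℓ) {p : PMF (History ℓ)}
    (hp : ∀ h ∈ p.support, h.length = T) : policyRegret A T p ≤ T := by
  refine policyRegret_le_of_forall fun y => ?_
  have hloss : expect p A.totalLoss ≤ T :=
    expect_le_of_forall_le ((List.finite_length_eq _ T).subset hp) fun h hh =>
      hp h hh ▸ A.totalLoss_le_length h
  linarith [A.totalLoss_nonneg (List.replicate T y)]

lemma policyRegret_le_zero_of_one_arm (A : Adversary 1) {p : PMF (History 1)}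
    (hp : ∀ h ∈ p.support, h.length = T) : policyRegret A T p ≤ 0 := by
  refine policyRegret_le_of_forall fun y => ?_
  rw [add_zero]
  refine expect_le_of_forall_le ((List.finite_length_eq _ T).subset hp) fun h hh => ?_
  rw [List.eq_replicate_of_mem (l := h) fun b _ => Subsingleton.elim b y, hp h hh]

variable {ε : unitInterval} {η : ℝ} {m d : ℕ}
  {τ : (Fin ℓ → ℝ) → (Fin ℓ → ℝ) → Fin ℓ → Fin ℓ → ℝ}

lemma policyRegret_play_le (hA : A.MemoryBounded m) (hd : m < d) (hε : 0 < (ε : ℝ)) (hη : 0 < η)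
    (hτ : IsCouplingRule τ) (T : ℕ) :
    policyRegret A T (play A ε η d τ T) ≤
      3 * d + ℓ * Real.log ℓ / (ε * (1 - Real.exp (-η))) + T * (η + ε * (4 * d + 3)) := by
  have hδ : 0 < 1 - Real.exp (-η) := by simpa using hη
  set B : ℝ := ℓ / (ε * (1 - Real.exp (-η))) with hB
  have hB0 : 0 ≤ B := by positivity
  have hεB : ε * B * (1 - Real.exp (-η)) = ℓ := by
    rw [hB]
    field_simp
  refine policyRegret_le_of_forall fun y => ?_
  have hfin := finite_support_run A ε η d τ T
  have hupper := expect_run_potential_le hA hd hη.le hB0 hεB hτ y T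
  have hlower : -(d : ℝ) ≤ expect (run A ε η d τ T) (potential A η B m d y T) :=
    le_expect_of_forall_le hfin fun s hs =>
      (valid_of_mem_support_run (by omega) hs).neg_le_potential hB0 A η m y
  rw [expect_add hfin] at hupper
  rw [play, expect_map hfin, mul_div_right_comm]
  linarith

end Regret

section Tuning

lemma le_two_mul_one_sub_exp_neg {η : ℝ} (hη : 0 ≤ η) (h : 1 - Real.exp (-η) ≤ 1 / 2) :
    η ≤ 2 * (1 - Real.exp (-η)) := by
  nlinarith [le_one_sub_exp_neg_mul_one_add η]

lemma policyRegret_play_le_of_tuned {ℓ m T : ℕ} [NeZero ℓ] {A : Adversary ℓ} {ε : unitInterval}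
    {η δ : ℝ} {τ : (Fin ℓ → ℝ) → (Fin ℓ → ℝ) → Fin ℓ → Fin ℓ → ℝ} (hm : 1 ≤ m)
    (hA : A.MemoryBounded m) (hτ : IsCouplingRule τ) (hδ : 0 < δ) (hη : 1 - Real.exp (-η) = δ)
    (hε : m * (ε : ℝ) = δ) (hcube : δ ^ 3 * T = m * ℓ * Real.log ℓ) (hmT : m ≤ δ * T) :
    policyRegret A T (play A ε η (m + 1) τ T) ≤ 20 * (δ * T) := by
  have hm1 : (1 : ℝ) ≤ m := by exact_mod_cast hm
  have hε0 : 0 < (ε : ℝ) := pos_of_mul_pos_right (hε ▸ hδ) (Nat.cast_nonneg m)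
  have hη0 : 0 < η := by simpa [← hη] using hδ
  rcases le_or_gt δ (1 / 2) with hsmall | hlarge
  · have hη2 : η ≤ 2 * δ := hη ▸ le_two_mul_one_sub_exp_neg hη0.le (hη ▸ hsmall)
    have hhedge : ℓ * Real.log ℓ / (ε * δ) = δ * T := by
      rw [div_eq_iff (by positivity)]
      apply mul_left_cancel₀ (show (m : ℝ) ≠ 0 by positivity)
      linear_combination -hcube - δ ^ 2 * T * hε
    have hε11 : ε * (4 * (m + 1 : ℝ) + 3) ≤ 11 * δ := by nlinarith
    calc policyRegret A T (play A ε η (m + 1) τ T)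
        ≤ 3 * (m + 1 : ℝ) + δ * T + T * (η + ε * (4 * (m + 1 : ℝ) + 3)) := by
          simpa [hη, hhedge] using policyRegret_play_le hA m.lt_succ_self hε0 hη0 hτ T
      _ ≤ 6 * (δ * T) + δ * T + T * (2 * δ + 11 * δ) := by
          gcongr ?_ + _ + T * (?_ + ?_)
          linarith
      _ = 20 * (δ * T) := by ring
  · have hhorizon : policyRegret A T (play A ε η (m + 1) τ T) ≤ T :=
      policyRegret_le_horizon A fun h => length_of_mem_support_play (by omega)
    nlinarith [Nat.cast_nonneg (α := ℝ) T]

lemma rpow_one_third_mul_rpow_two_thirds {x : ℝ} (hx : 0 ≤ x) :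
    x ^ (1 / 3 : ℝ) * x ^ (2 / 3 : ℝ) = x := by
  rw [← Real.rpow_add' hx] <;> norm_num

lemma mul_rpow_neg_two_thirds {x : ℝ} (hx : 0 ≤ x) :
    x * x ^ (-(2 / 3) : ℝ) = x ^ (1 / 3 : ℝ) := by
  rw [← Real.rpow_one_add' hx] <;> norm_num

lemma rpow_neg_one_third_mul_self {x : ℝ} (hx : 0 ≤ x) :
    x ^ (-(1 / 3) : ℝ) * x = x ^ (2 / 3 : ℝ) := by
  rw [← Real.rpow_add_one' hx] <;> norm_num

lemma rpow_one_third_mul_rpow_neg_one_third_pow_three_mul {x y : ℝ} (hx : 0 ≤ x) (hy : 0 < y) :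
    (x ^ (1 / 3 : ℝ) * y ^ (-(1 / 3) : ℝ)) ^ 3 * y = x := by
  rw [mul_pow, ← Real.rpow_mul_natCast hx, ← Real.rpow_mul_natCast hy.le]
  norm_num [Real.rpow_neg_one, hy.ne']

lemma le_rpow_one_third_mul_rpow_two_thirds {x y z : ℝ} (hx : 0 ≤ x) (hy : x ≤ y) (hz : x ≤ z) :
    x ≤ y ^ (1 / 3 : ℝ) * z ^ (2 / 3 : ℝ) :=
  calc x = x ^ (1 / 3 : ℝ) * x ^ (2 / 3 : ℝ) := (rpow_one_third_mul_rpow_two_thirds hx).symm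
    _ ≤ y ^ (1 / 3 : ℝ) * z ^ (2 / 3 : ℝ) := by
      have hy0 : 0 ≤ y := hx.trans hy
      gcongr

lemma one_le_mul_log {x : ℝ} (hx : 2 ≤ x) : 1 ≤ x * Real.log x := by
  nlinarith [Real.log_two_gt_d9, Real.log_le_log two_pos hx]

end Tuning

end MemoryBandit

end

open MemoryBandit in
theorem mainTheorem5_general :
    ∃ C : ℝ, 0 < C ∧
      ∀ (ℓ m T : ℕ) [NeZero ℓ], 1 ≤ m →
      ∀ (ε : unitInterval) (η : ℝ),
      ((m : ℝ) * ℓ * Real.log ℓ < T →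
        (ε : ℝ) = ((ℓ : ℝ) * Real.log ℓ) ^ (1 / 3 : ℝ) * (m : ℝ) ^ (-(2 / 3) : ℝ)
            * (T : ℝ) ^ (-(1 / 3) : ℝ) ∧
        1 - Real.exp (-η) = ((m : ℝ) * ℓ * Real.log ℓ) ^ (1 / 3 : ℝ) * (T : ℝ) ^ (-(1 / 3) : ℝ)) →
      ∀ τ : (Fin ℓ → ℝ) → (Fin ℓ → ℝ) → Fin ℓ → Fin ℓ → ℝ, IsCouplingRule τ →
      ∀ A : Adversary ℓ, A.MemoryBounded m →
        policyRegret A T (play A ε η (m + 1) τ T)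
          ≤ C * ((m : ℝ) * ℓ * Real.log ℓ) ^ (1 / 3 : ℝ) * (T : ℝ) ^ (2 / 3 : ℝ) := by
  refine ⟨20, by norm_num, fun ℓ m T _ hm ε η hpar τ hτ A hA => ?_⟩
  have hm0 : (0 : ℝ) < m := by exact_mod_cast hm
  have hhorizon : ∀ h ∈ (play A ε η (m + 1) τ T).support, h.length = T := fun h =>
    length_of_mem_support_play (by omega)
  rcases (NeZero.one_le : 1 ≤ ℓ).eq_or_lt with rfl | hℓ
  · simpa using policyRegret_le_zero_of_one_arm A hhorizon
  have hmK : (m : ℝ) ≤ m * ℓ * Real.log ℓ := by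
    rw [mul_assoc]
    exact le_mul_of_one_le_right hm0.le (one_le_mul_log (by exact_mod_cast hℓ))
  rw [mul_assoc (20 : ℝ)]
  rcases le_or_gt (T : ℝ) (m * ℓ * Real.log ℓ) with hT | hT
  · linarith [policyRegret_le_horizon A hhorizon, Nat.cast_nonneg (α := ℝ) T,
      le_rpow_one_third_mul_rpow_two_thirds (Nat.cast_nonneg T) hT le_rfl]
  · obtain ⟨hε, hη⟩ := hpar hT
    have hK : (0 : ℝ) < m * ℓ * Real.log ℓ := hm0.trans_le hmK
    have hT0 : (0 : ℝ) < T := hK.trans hT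
    rw [← rpow_neg_one_third_mul_self hT0.le, ← mul_assoc (_ ^ _)]
    refine policyRegret_play_le_of_tuned hm hA hτ (by positivity) hη ?_
      (rpow_one_third_mul_rpow_neg_one_third_pow_three_mul hK.le hT0) ?_
    · rw [hε, mul_assoc (m : ℝ), Real.mul_rpow hm0.le (by positivity),
        ← mul_rpow_neg_two_thirds hm0.le]
      ring
    · rw [mul_assoc, rpow_neg_one_third_mul_self hT0.le]
      exact le_rpow_one_third_mul_rpow_two_thirds hm0.le hmK (hmK.trans hT.le)

theorem mainTheorem5 :
    ∃ C : ℝ, 0 < C ∧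
      ∀ (ℓ m T : ℕ) [NeZero ℓ], 1 ≤ m →
      ∀ (ε : unitInterval) (η : ℝ), 0 ≤ η →
      ((m : ℝ) * ℓ * Real.log ℓ < T →
        (ε : ℝ) = ((ℓ : ℝ) * Real.log ℓ) ^ (1 / 3 : ℝ) * (m : ℝ) ^ (-(2 / 3) : ℝ)
            * (T : ℝ) ^ (-(1 / 3) : ℝ) ∧
        1 - Real.exp (-η) = ((m : ℝ) * ℓ * Real.log ℓ) ^ (1 / 3 : ℝ) * (T : ℝ) ^ (-(1 / 3) : ℝ)) →
      ∀ τ : (Fin ℓ → ℝ) → (Fin ℓ → ℝ) → Fin ℓ → Fin ℓ → ℝ, MemoryBandit.IsTransportRule τ →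
      ∀ A : MemoryBandit.Adversary ℓ, A.MemoryBounded m →
        MemoryBandit.policyRegret A T (MemoryBandit.play A ε η (m + 1) τ T)
          ≤ C * ((m : ℝ) * ℓ * Real.log ℓ) ^ (1 / 3 : ℝ) * (T : ℝ) ^ (2 / 3 : ℝ) := by
  obtain ⟨C, hC, hregret⟩ := mainTheorem5_general
  exact ⟨C, hC, fun ℓ m T _ hm ε η _ hpar τ hτ => hregret ℓ m T hm ε η hpar τ hτ.isCouplingRule⟩
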